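/- **Theorem.** Let $d\ge 1$ and $\kappa=(\kappa_1,\dots,\kappa_{d+1})\in\mathbb R^{d+1}$ with all $\kappa_i>-1$; write $|\kappa|=\kappa_1+\cdots+\kappa_{d+1}$ and $(a)_k=a(a+1)\cdots(a+k-1)$. Let $T^d=\{x\in\mathbb R^d: x_i\ge 0,\ x_1+\cdots+x_d\le 1\}$, $|x|=x_1+\cdots+x_d$, $W_\kappa(x)=x_1^{\kappa_1}\cdots x_d^{\kappa_d}(1-|x|)^{\kappa_{d+1}}$, and $$\langle f,g\rangle=\frac{\Gamma(|\kappa|+d+1)}{\prod_{i=1}^{d+1}\Gamma(\kappa_i+1)}\int_{T^d}f(x)g(x)W_\kappa(x)\,dx .$$ Let $\mathcal V_n^d(W_\kappa)$ be the space of real polynomials of degree at most $n$ in $d$ variables that are orthogonal to all polynomials of degree less than $n$. Let $P_n(W_\kappa;\cdot,\cdot)$ be its reproducing kernel, that is, the unique function on $\mathbb R^d\times\mathbb R^d$ that belongs to $\mathcal V_n^d(W_\kappa)$ in each variable and satisfies $\langle P_n(W_\kappa;x,\cdot),Q\rangle=Q(x)$ for all $Q\in\mathcal V_n^d(W_\kappa)$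 and $x\in\mathbb R^d$. For $\alpha\in\mathbb N_0^{d+1}$ put $|\alpha|=\alpha_1+\cdots+\alpha_{d+1}$, $\alpha!=\prod_{i=1}^{d+1}\alpha_i!$, $(\kappa+\mathbf 1)_\alpha=\prod_{i=1}^{d+1}(\kappa_i+1)_{\alpha_i}$ and $X^\alpha=x_1^{\alpha_1}\cdots x_d^{\alpha_d}(1-|x|)^{\alpha_{d+1}}$, and let $R^\kappa_{\alpha,n}$ be the (unique) orthogonal projection of $X^\alpha$ onto $\mathcal V_n^d(W_\kappa)$. Then this kernel and these projections exist and are unique, and for all integers $N\ge n\ge 0$ and all $x,y\in\mathbb R^d$, $$P_n(W_\kappa;x,y)=C_{n,N}\sum_{|\alpha|=N}\frac{R^\kappa_{\alpha,n}(x)\,R^\kappa_{\alpha,n}(y)}{(\kappa+\mathbf 1)_\alpha\,\alpha!},\qquad C_{n,N}=\frac{(|\kappa|+d+1)_{N+n}\,N!}{(-1)^n(-N)_n}.$$ Consequently the normalized projections $$\varphi_{\alpha,n}=\Big(\frac{C_{n,|\alpha|}}{(\kappa+\mathbf 1)_\alpha\,\alpha!}\Big)^{1/2}R^\kappa_{\alpha,n}$$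 form tight frames with frame bound $1$: for $N\ge n$ and every $f\in\mathcal V_n^d(W_\kappa)$, $\sum_{|\alpha|=N}\langle f,\varphi_{\alpha,n}\rangle^2=\langle f,f\rangle$; and for every choice of integers $N_n\ge n$ $(n=0,1,2,\dots)$ and every real-valued $f\in L^2(T^d,W_\kappa)$, $\sum_{n=0}^\infty\sum_{|\alpha|=N_n}\langle f,\varphi_{\alpha,n}\rangle^2=\langle f,f\rangle$, where the $\varphi_{\alpha,n}$ in question belong to $\mathcal V_n^d(W_\kappa)$, respectively to $L^2(T^d,W_\kappa)$. -/

import Mathlib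

namespace JacobiSimplex

open MeasureTheory

/-- The simplex `T^d = {x ∈ ℝ^d : x_i ≥ 0, x_1 + ⋯ + x_d ≤ 1}`. -/
def simplex (d : ℕ) : Set (Fin d → ℝ) :=
  {x | (∀ i, 0 ≤ x i) ∧ ∑ i, x i ≤ 1}

/-- The Jacobi weight `W_κ(x) = x_1^{κ_1} ⋯ x_d^{κ_d} (1 - |x|)^{κ_{d+1}}`. -/
noncomputable def weight {d : ℕ} (κ : Fin (d + 1) → ℝ) (x : Fin d → ℝ) : ℝ :=
  (∏ i : Fin d, x i ^ κ i.castSucc) * (1 - ∑ i, x i) ^ κ (Fin.last d)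

/-- The normalized inner product
`⟨f, g⟩ = Γ(|κ| + d + 1) / ∏ Γ(κ_i + 1) * ∫_{T^d} f g W_κ`. -/
noncomputable def inner {d : ℕ} (κ : Fin (d + 1) → ℝ) (f g : (Fin d → ℝ) → ℝ) : ℝ :=
  Real.Gamma ((∑ i, κ i) + d + 1) / (∏ i, Real.Gamma (κ i + 1)) *
    ∫ x in simplex d, f x * g x * weight κ x

/-- The real-valued functions in `L²(T^d, W_κ)`. -/
def squareIntegrable {d : ℕ} (κ : Fin (d + 1) → ℝ) : Set ((Fin d → ℝ) → ℝ) :=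
  {f | MemLp f 2
    ((volume.restrict (simplex d)).withDensity fun x => ENNReal.ofReal (weight κ x))}

/-- The function on `ℝ^d` given by a polynomial. -/
noncomputable def polyFun {d : ℕ} (p : MvPolynomial (Fin d) ℝ) : (Fin d → ℝ) → ℝ :=
  fun x => MvPolynomial.eval x p

/-- `V_n^d(W_κ)`: polynomials of degree at most `n` that are orthogonal to all polynomials
of degree less than `n`. -/
def orthPolys {d : ℕ} (κ : Fin (d + 1) → ℝ) (n : ℕ) : Set (MvPolynomial (Fin d) ℝ) :=
  {p | p.totalDegree ≤ n ∧
    ∀ q : MvPolynomial (Fin d) ℝ, q.totalDegree < n → inner κ (polyFun p) (polyFun q) = 0}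

/-- The elements of `V_n^d(W_κ)` as functions on `ℝ^d`. -/
def orthPolyFuns {d : ℕ} (κ : Fin (d + 1) → ℝ) (n : ℕ) : Set ((Fin d → ℝ) → ℝ) :=
  polyFun '' orthPolys κ n

/-- `K` is a reproducing kernel of `V_n^d(W_κ)`: it lies in `V_n^d(W_κ)` as a function of either
variable, and `⟨K(x, ·), f⟩ = f(x)` for all `f` in `V_n^d(W_κ)`. -/
def IsReproducingKernel {d : ℕ} (κ : Fin (d + 1) → ℝ) (n : ℕ)
    (K : (Fin d → ℝ) → (Fin d → ℝ) → ℝ) : Prop :=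
  (∀ x, (fun y => K x y) ∈ orthPolyFuns κ n) ∧
  (∀ y, (fun x => K x y) ∈ orthPolyFuns κ n) ∧
  ∀ f ∈ orthPolyFuns κ n, ∀ x, inner κ (fun y => K x y) f = f x

/-- `P_n(W_κ; ·, ·)`, the reproducing kernel of `V_n^d(W_κ)`. -/
noncomputable def kernel {d : ℕ} (κ : Fin (d + 1) → ℝ) (n : ℕ) :
    (Fin d → ℝ) → (Fin d → ℝ) → ℝ :=
  Classical.epsilon (IsReproducingKernel κ n)

/-- `r` is an orthogonal projection of the polynomial `p` onto `V_n^d(W_κ)`. -/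
def IsOrthProj {d : ℕ} (κ : Fin (d + 1) → ℝ) (n : ℕ) (p r : MvPolynomial (Fin d) ℝ) : Prop :=
  r ∈ orthPolys κ n ∧ ∀ q ∈ orthPolys κ n, inner κ (polyFun (p - r)) (polyFun q) = 0

/-- The orthogonal projection of the polynomial `p` onto `V_n^d(W_κ)`. -/
noncomputable def orthProj {d : ℕ} (κ : Fin (d + 1) → ℝ) (n : ℕ)
    (p : MvPolynomial (Fin d) ℝ) : MvPolynomial (Fin d) ℝ :=
  Classical.epsilon (IsOrthProj κ n p)

/-- `X^α = x_1^{α_1} ⋯ x_d^{α_d} (1 - |x|)^{α_{d+1}}` as a polynomial in `x_1, …, x_d`. -/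
noncomputable def monomialX {d : ℕ} (α : Fin (d + 1) → ℕ) : MvPolynomial (Fin d) ℝ :=
  (∏ i : Fin d, MvPolynomial.X i ^ α i.castSucc) *
    (1 - ∑ i : Fin d, MvPolynomial.X i) ^ α (Fin.last d)

/-- `R_{α,n}^κ`, the orthogonal projection of `X^α` onto `V_n^d(W_κ)`, as a function on `ℝ^d`. -/
noncomputable def R {d : ℕ} (κ : Fin (d + 1) → ℝ) (α : Fin (d + 1) → ℕ) (n : ℕ) :
    (Fin d → ℝ) → ℝ :=
  polyFun (orthProj κ n (monomialX α))

/-- The Pochhammer symbol `(a)_k = a (a + 1) ⋯ (a + k - 1)`. -/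
noncomputable def poch (a : ℝ) (k : ℕ) : ℝ := (ascPochhammer ℝ k).eval a

/-- `(κ + 1)_α α!`. -/
noncomputable def frameWeight {d : ℕ} (κ : Fin (d + 1) → ℝ) (α : Fin (d + 1) → ℕ) : ℝ :=
  (∏ i, poch (κ i + 1) (α i)) * ∏ i, ((α i).factorial : ℝ)

/-- `(|κ| + d + 1)_{N+n} N! / ((-1)^n (-N)_n)`. -/
noncomputable def frameConst {d : ℕ} (κ : Fin (d + 1) → ℝ) (n N : ℕ) : ℝ :=
  poch ((∑ i, κ i) + d + 1) (N + n) * (N.factorial : ℝ) / ((-1) ^ n * poch (-(N : ℝ)) n)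

/-- Multi-indices `α ∈ ℕ_0^{d+1}` with `|α| = N`. -/
abbrev MultiIndex (d N : ℕ) : Type := {α : Fin (d + 1) → ℕ // ∑ i, α i = N}

/-- The normalized projection
`(frameConst κ n |α| / ((κ + 1)_α α!))^{1/2} R_{α,n}^κ`. -/
noncomputable def frameFun {d : ℕ} (κ : Fin (d + 1) → ℝ) (α : Fin (d + 1) → ℕ) (n : ℕ) :
    (Fin d → ℝ) → ℝ :=
  fun x => Real.sqrt (frameConst κ n (∑ i, α i) / frameWeight κ α) * R κ α n x

/-- The family `φ` is a tight frame of the space `S` of functions, with frame bound `A`, for the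
inner product of `L²(T^d, W_κ)`. -/
def IsTightFrame {d : ℕ} (κ : Fin (d + 1) → ℝ) (S : Set ((Fin d → ℝ) → ℝ)) {ι : Type}
    (φ : ι → (Fin d → ℝ) → ℝ) (A : ℝ) : Prop :=
  0 < A ∧ (∀ i, φ i ∈ S) ∧
    ∀ f ∈ S, HasSum (fun i => inner κ f (φ i) ^ 2) (A * inner κ f f)

end JacobiSimplex

/-!
The kernel formula says that, on `V_n^d(W_κ)`, a Durrmeyer-type operator is a multiple of the
identity. For `N ≥ n` consider
`T p = ∑_{|α| = N} ⟨p, X^α⟩ X^α / ((κ + 1)_α α!)`.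
It is self-adjoint for `⟨·, ·⟩`. By Dirichlet's integral (`lintegral_dirichletIntegrand`,
`integral_monomialX`) the moments are `⟨X^β, X^α⟩ = (κ + 1)_{α+β} / (|κ| + d + 1)_{|α|+|β|}`, so `T X^β` is
a constant times `∑_{|α| = N} (κ + 1 + α)_β X^α / α!`. Expanding `(κ + 1 + α)_β` in falling factorials
of `α` and applying the multinomial theorem to the barycentric coordinates, whose sum is `1`, shows
that `T` multiplies the leading part of a polynomial of degree `n` by `1 / C_{n,N}` and adds only terms
of lower degree (`sum_poch_smul_monomialX_sub_mem_polyLT`, `durrmeyer_sub_mem_polyLT`). A self-adjoint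
operator with this property acts on `V_n^d(W_κ)` as the scalar `1 / C_{n,N}` (`durrmeyer_eq_smul`).

For `p` in `V_n^d(W_κ)` one has `⟨p, X^α⟩ = ⟨p, R_{α,n}⟩`. Projecting `C_{n,N} T p = p` onto `V_n^d(W_κ)`
gives the reproducing property of the sum, and pairing it with `p` gives the tight frame identity.
In `L²(T^d, W_κ)` polynomials are dense, so this space is the Hilbert sum of the `V_n^d(W_κ)`
(`isHilbertSum_orthSubmodule`); adding the frame identities of the components of `f` gives Parseval's
identity for the whole system.
-/

namespace JacobiSimplex

open MeasureTheory

/-! ### Dirichlet's integral -/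

/-- The beta integral on `(0, s)`. -/
lemma lintegral_rpow_mul_sub_rpow {a b s : ℝ} (ha : -1 < a) (hb : -1 < b) (hs : 0 < s) :
    ∫⁻ t in Set.Ioo 0 s, ENNReal.ofReal (t ^ a * (s - t) ^ b) =
      ENNReal.ofReal (s ^ (a + b + 1) *
        (Real.Gamma (a + 1) * Real.Gamma (b + 1) / Real.Gamma (a + b + 2))) := by
  have hB : 0 < ProbabilityTheory.beta (a + 1) (b + 1) :=
    ProbabilityTheory.beta_pos (by linarith) (by linarith)
  have himg : Set.Ioo (0 : ℝ) s = (fun u => s * u) '' Set.Ioo 0 1 := by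
    rw [Set.image_mul_left_Ioo hs]; simp
  have hone : ∫⁻ t in Set.Ioo (0 : ℝ) 1, ENNReal.ofReal (t ^ a * (1 - t) ^ b) =
      ENNReal.ofReal (ProbabilityTheory.beta (a + 1) (b + 1)) := by
    have h := ProbabilityTheory.lintegral_betaPDF_eq_one (α := a + 1) (β := b + 1)
      (by linarith) (by linarith)
    rw [ProbabilityTheory.lintegral_betaPDF] at h
    simp only [add_sub_cancel_right, mul_assoc] at h
    simp_rw [ENNReal.ofReal_mul (one_div_pos.2 hB).le] at h
    rw [lintegral_const_mul' _ _ ENNReal.ofReal_ne_top] at h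
    rw [← mul_one (ENNReal.ofReal (ProbabilityTheory.beta (a + 1) (b + 1))), ← h, ← mul_assoc,
      ← ENNReal.ofReal_mul hB.le, mul_one_div_cancel hB.ne', ENNReal.ofReal_one, one_mul]
  rw [himg, lintegral_image_eq_lintegral_abs_deriv_mul measurableSet_Ioo
    (f' := fun _ => s) (fun x _ => by simpa using ((hasDerivAt_id x).const_mul s).hasDerivWithinAt)
    (fun x _ y _ h => mul_left_cancel₀ hs.ne' h)]
  have hcongr : ∀ u ∈ Set.Ioo (0 : ℝ) 1,
      ENNReal.ofReal |s| * ENNReal.ofReal ((s * u) ^ a * (s - s * u) ^ b) =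
        ENNReal.ofReal (s ^ (a + b + 1)) * ENNReal.ofReal (u ^ a * (1 - u) ^ b) := by
    intro u hu
    rw [abs_of_pos hs, ← ENNReal.ofReal_mul hs.le, ← ENNReal.ofReal_mul (by positivity)]
    congr 1
    rw [← mul_one_sub, Real.mul_rpow hs.le hu.1.le, Real.mul_rpow hs.le (by linarith [hu.2]),
      Real.rpow_add hs, Real.rpow_add hs, Real.rpow_one]
    ring
  rw [setLIntegral_congr_fun measurableSet_Ioo hcongr,
    lintegral_const_mul' _ _ ENNReal.ofReal_ne_top, hone, ← ENNReal.ofReal_mul (by positivity),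
    ProbabilityTheory.beta]
  ring_nf

/-- The simplex `{x : x_i ≥ 0, |x| ≤ s}` of size `s`. -/
def scaledSimplex (d : ℕ) (s : ℝ) : Set (Fin d → ℝ) :=
  {x | (∀ i, 0 ≤ x i) ∧ ∑ i, x i ≤ s}

lemma measurableSet_scaledSimplex (d : ℕ) (s : ℝ) : MeasurableSet (scaledSimplex d s) := by
  have h : scaledSimplex d s = (⋂ i, {x | 0 ≤ x i}) ∩ {x | ∑ i, x i ≤ s} := by
    ext x; simp [scaledSimplex]
  rw [h]
  exact (MeasurableSet.iInter fun i => measurableSet_le measurable_const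
    (measurable_pi_apply i)).inter (measurableSet_le (by fun_prop) measurable_const)

/-- The Dirichlet integrand `x_1^{κ_1} ⋯ x_d^{κ_d} (s - |x|)^{κ_{d+1}}` on the simplex of size `s`,
extended by zero. -/
noncomputable def dirichletIntegrand {d : ℕ} (κ : Fin (d + 1) → ℝ) (s : ℝ) :
    (Fin d → ℝ) → ENNReal :=
  (scaledSimplex d s).indicator fun x =>
    ENNReal.ofReal ((∏ i : Fin d, x i ^ κ i.castSucc) * (s - ∑ i, x i) ^ κ (Fin.last d))

lemma measurable_dirichletIntegrand {d : ℕ} (κ : Fin (d + 1) → ℝ) (s : ℝ) :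
    Measurable (dirichletIntegrand κ s) := by
  refine Measurable.indicator ?_ (measurableSet_scaledSimplex d s)
  fun_prop

lemma dirichletIntegrand_cons {d : ℕ} (κ : Fin (d + 2) → ℝ) (s t : ℝ) (y : Fin d → ℝ) :
    dirichletIntegrand κ s (Fin.cons t y) =
      (Set.Ici 0).indicator (fun t => ENNReal.ofReal (t ^ κ 0)) t *
        dirichletIntegrand (Fin.tail κ) (s - t) y := by
  have hmem : (Fin.cons t y : Fin (d + 1) → ℝ) ∈ scaledSimplex (d + 1) s ↔
      t ∈ Set.Ici (0 : ℝ) ∧ y ∈ scaledSimplex d (s - t) := by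
    simp only [scaledSimplex, Set.mem_ofPred_eq, Fin.forall_fin_succ, Fin.cons_zero, Fin.cons_succ,
      Fin.sum_univ_succ, Set.mem_Ici, le_sub_iff_add_le', and_assoc]
  by_cases ht : t ∈ Set.Ici (0 : ℝ)
  · by_cases hy : y ∈ scaledSimplex d (s - t)
    · rw [dirichletIntegrand, Set.indicator_of_mem (hmem.2 ⟨ht, hy⟩), dirichletIntegrand,
        Set.indicator_of_mem ht, Set.indicator_of_mem hy,
        ← ENNReal.ofReal_mul (Real.rpow_nonneg ht _)]
      congr 1
      simp only [Fin.prod_univ_succ, Fin.sum_univ_succ, Fin.cons_zero, Fin.cons_succ, Fin.tail,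
        Fin.castSucc_zero, Fin.succ_last, ← Fin.succ_castSucc, mul_assoc, sub_sub]
    · rw [dirichletIntegrand, Set.indicator_of_notMem (fun h => hy (hmem.1 h).2),
        dirichletIntegrand, Set.indicator_of_notMem hy, mul_zero]
  · rw [dirichletIntegrand, Set.indicator_of_notMem (fun h => ht (hmem.1 h).1),
      Set.indicator_of_notMem ht, zero_mul]

lemma sum_add_gt_neg_one {d : ℕ} {κ : Fin (d + 1) → ℝ} (hκ : ∀ i, -1 < κ i) :
    -1 < (∑ i, κ i) + d := by
  have h : ∑ i : Fin (d + 1), (-1 : ℝ) < ∑ i, κ i :=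
    Finset.sum_lt_sum_of_nonempty ⟨0, Finset.mem_univ _⟩ fun i _ => hκ i
  simp at h
  linarith

/-- Dirichlet's integral: one variable at a time, it is a beta integral. -/
theorem lintegral_dirichletIntegrand {d : ℕ} (κ : Fin (d + 1) → ℝ) (hκ : ∀ i, -1 < κ i) {s : ℝ}
    (hs : 0 < s) :
    ∫⁻ x, dirichletIntegrand κ s x = ENNReal.ofReal (s ^ ((∑ i, κ i) + d) *
      ((∏ i, Real.Gamma (κ i + 1)) / Real.Gamma ((∑ i, κ i) + d + 1))) := by
  induction d generalizing s with
  | zero =>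
    have hG : Real.Gamma (κ 0 + 1) ≠ 0 := (Real.Gamma_pos_of_pos (by linarith [hκ 0])).ne'
    simp [dirichletIntegrand, scaledSimplex, hs.le, div_self hG, lintegral_unique,
      volume_pi]
  | succ d ih =>
    have hκ' : ∀ i, -1 < Fin.tail κ i := fun i => hκ _
    set A : ℝ := (∑ i, Fin.tail κ i) + d with hA
    have hA1 : -1 < A := sum_add_gt_neg_one hκ'
    set C : ℝ := (∏ i, Real.Gamma (Fin.tail κ i + 1)) / Real.Gamma (A + 1) with hC
    have hC0 : 0 ≤ C := div_nonneg (Finset.prod_nonneg fun i _ =>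
      (Real.Gamma_pos_of_pos (by linarith [hκ' i])).le)
      (Real.Gamma_pos_of_pos (by linarith)).le
    have hGA : Real.Gamma (A + 1) ≠ 0 := (Real.Gamma_pos_of_pos (by linarith)).ne'
    have hsum : ∑ i, κ i = κ 0 + ∑ i, Fin.tail κ i := Fin.sum_univ_succ κ
    have hprod : ∏ i, Real.Gamma (κ i + 1) =
        Real.Gamma (κ 0 + 1) * ∏ i, Real.Gamma (Fin.tail κ i + 1) :=
      Fin.prod_univ_succ _
    have e := (volume_preserving_piFinSuccAbove (fun _ : Fin (d + 1) => ℝ) 0).symm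
    have hm : Measurable fun p : ℝ × (Fin d → ℝ) => dirichletIntegrand κ s
        ((MeasurableEquiv.piFinSuccAbove (fun _ : Fin (d + 1) => ℝ) 0).symm p) :=
      (measurable_dirichletIntegrand κ s).comp (MeasurableEquiv.measurable _)
    rw [← e.lintegral_comp (measurable_dirichletIntegrand κ s), Measure.volume_eq_prod,
      lintegral_prod _ hm.aemeasurable]
    -- For fixed `t` in `(0, s)` the inner integral is the one over the simplex of size `s - t`; for
    -- other `t` it vanishes, up to the end points, which are null.
    have hinner : ∀ᵐ t : ℝ, ∫⁻ y : Fin d → ℝ, dirichletIntegrand κ s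
        ((MeasurableEquiv.piFinSuccAbove (fun _ : Fin (d + 1) => ℝ) 0).symm (t, y)) =
        (Set.Ioo 0 s).indicator
          (fun t => ENNReal.ofReal C * ENNReal.ofReal (t ^ κ 0 * (s - t) ^ A)) t := by
      have h0 : ∀ᵐ t : ℝ, t ≠ 0 := by simp [ae_iff]
      have h1 : ∀ᵐ t : ℝ, t ≠ s := by simp [ae_iff]
      filter_upwards [h0, h1] with t ht0 hts
      have hcons : ∀ y : Fin d → ℝ,
          (MeasurableEquiv.piFinSuccAbove (fun _ : Fin (d + 1) => ℝ) 0).symm (t, y) =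
            Fin.cons t y := fun y =>
        Fin.insertNth_zero' t y
      simp_rw [hcons, dirichletIntegrand_cons]
      rw [lintegral_const_mul _ (measurable_dirichletIntegrand _ _)]
      by_cases ht : t ∈ Set.Ioo 0 s
      · rw [Set.indicator_of_mem ht, Set.indicator_of_mem (Set.mem_Ici.2 ht.1.le),
          ih _ hκ' (sub_pos.2 ht.2), ← ENNReal.ofReal_mul hC0,
          ← ENNReal.ofReal_mul (Real.rpow_nonneg ht.1.le _)]
        congr 1
        rw [← hA, ← hC]; ring
      · rw [Set.indicator_of_notMem ht]
        by_cases htn : 0 ≤ t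
        · have hst : s < t := lt_of_le_of_ne (not_lt.1 fun h =>
            ht ⟨lt_of_le_of_ne htn (Ne.symm ht0), h⟩) (Ne.symm hts)
          have : ∀ y, dirichletIntegrand (Fin.tail κ) (s - t) y = 0 := fun y =>
            Set.indicator_of_notMem (fun hy => by
              have := hy.2
              have := Finset.sum_nonneg fun i (_ : i ∈ Finset.univ) => hy.1 i
              linarith) _
          simp [this]
        · rw [Set.indicator_of_notMem (by simpa using htn), zero_mul]
    rw [lintegral_congr_ae hinner, lintegral_indicator measurableSet_Ioo,
      lintegral_const_mul' _ _ ENNReal.ofReal_ne_top,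
      lintegral_rpow_mul_sub_rpow (hκ 0) hA1 hs, ← ENNReal.ofReal_mul hC0]
    have e1 : κ 0 + A + 1 = (∑ i, κ i) + ((d + 1 : ℕ) : ℝ) := by
      rw [hsum, hA]; push_cast; ring
    have e2 : κ 0 + A + 2 = (∑ i, κ i) + ((d + 1 : ℕ) : ℝ) + 1 := by rw [← e1]; ring
    rw [e1, e2, hprod, hC]
    congr 1
    field_simp

/-! ### The Jacobi weight on the simplex -/

/-- The measure `W_κ(x) dx` on the simplex. -/
noncomputable def jacobiMeasure {d : ℕ} (κ : Fin (d + 1) → ℝ) : Measure (Fin d → ℝ) :=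
  (volume.restrict (simplex d)).withDensity fun x => ENNReal.ofReal (weight κ x)

/-- The constant that normalizes `jacobiMeasure` to a probability measure. -/
noncomputable def jacobiConst {d : ℕ} (κ : Fin (d + 1) → ℝ) : ℝ :=
  Real.Gamma ((∑ i, κ i) + d + 1) / (∏ i, Real.Gamma (κ i + 1))

lemma measurableSet_simplex (d : ℕ) : MeasurableSet (simplex d) :=
  measurableSet_scaledSimplex d 1

lemma measurable_weight {d : ℕ} (κ : Fin (d + 1) → ℝ) : Measurable (weight κ) := by
  unfold weight; fun_prop

lemma weight_nonneg {d : ℕ} (κ : Fin (d + 1) → ℝ) {x : Fin d → ℝ} (hx : x ∈ simplex d) :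
    0 ≤ weight κ x :=
  mul_nonneg (Finset.prod_nonneg fun i _ => Real.rpow_nonneg (hx.1 i) _)
    (Real.rpow_nonneg (sub_nonneg.2 hx.2) _)

lemma isCompact_simplex (d : ℕ) : IsCompact (simplex d) := by
  have hc : IsClosed (simplex d) := by
    have h : simplex d = (⋂ i, {x | 0 ≤ x i}) ∩ {x | ∑ i, x i ≤ 1} := by
      ext x; simp [simplex]
    rw [h]
    exact (isClosed_iInter fun i => isClosed_le continuous_const (continuous_apply i)).inter
      (isClosed_le (by fun_prop) continuous_const)
  refine (isCompact_univ_pi fun _ : Fin d => isCompact_Icc (a := (0 : ℝ)) (b := 1)).of_isClosed_subset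
    hc fun x hx i _ => ⟨hx.1 i, ?_⟩
  exact (Finset.single_le_sum (fun j _ => hx.1 j) (Finset.mem_univ i)).trans hx.2

section
variable {d : ℕ} {κ : Fin (d + 1) → ℝ}

lemma jacobiConst_pos (hκ : ∀ i, -1 < κ i) : 0 < jacobiConst κ :=
  div_pos (Real.Gamma_pos_of_pos (by linarith [sum_add_gt_neg_one hκ]))
    (Finset.prod_pos fun i _ => Real.Gamma_pos_of_pos (by linarith [hκ i]))

lemma lintegral_weight (hκ : ∀ i, -1 < κ i) :
    ∫⁻ x in simplex d, ENNReal.ofReal (weight κ x) = ENNReal.ofReal (jacobiConst κ)⁻¹ := by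
  have h := lintegral_dirichletIntegrand κ hκ one_pos
  unfold dirichletIntegrand at h
  rw [lintegral_indicator (measurableSet_scaledSimplex d 1), Real.one_rpow, one_mul] at h
  rw [jacobiConst, inv_div, ← h]
  rfl

lemma isFiniteMeasure_jacobiMeasure (hκ : ∀ i, -1 < κ i) : IsFiniteMeasure (jacobiMeasure κ) := by
  refine ⟨?_⟩
  rw [jacobiMeasure, withDensity_apply _ MeasurableSet.univ, Measure.restrict_univ,
    lintegral_weight hκ]
  exact ENNReal.ofReal_lt_top

lemma integral_jacobiMeasure (κ : Fin (d + 1) → ℝ) (g : (Fin d → ℝ) → ℝ) :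
    ∫ x, g x ∂jacobiMeasure κ = ∫ x in simplex d, g x * weight κ x := by
  rw [jacobiMeasure, integral_withDensity_eq_integral_toReal_smul
    (measurable_weight κ).ennreal_ofReal (by simp)]
  refine setIntegral_congr_fun (measurableSet_simplex d) fun x hx => ?_
  simp only [smul_eq_mul, ENNReal.toReal_ofReal (weight_nonneg κ hx), mul_comm]

lemma inner_eq_integral (κ : Fin (d + 1) → ℝ) (f g : (Fin d → ℝ) → ℝ) :
    inner κ f g = jacobiConst κ * ∫ x, f x * g x ∂jacobiMeasure κ := by
  rw [integral_jacobiMeasure]; rfl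

lemma ae_mem_simplex (κ : Fin (d + 1) → ℝ) : ∀ᵐ x ∂jacobiMeasure κ, x ∈ simplex d :=
  (withDensity_absolutelyContinuous _ _).ae_le (ae_restrict_mem (measurableSet_simplex d))

/-- A proper affine hyperplane is null; `x₀` witnesses that the level set is proper. -/
lemma ae_linearMap_ne (L : (Fin d → ℝ) →ₗ[ℝ] ℝ) (c : ℝ) {x₀ : Fin d → ℝ}
    (h : L x₀ ≠ c) : ∀ᵐ x : Fin d → ℝ, L x ≠ c := by
  let s : AffineSubspace ℝ (Fin d → ℝ) :=
    { carrier := {x | L x = c}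
      smul_vsub_vadd_mem' := by
        intro t p q r hp hq hr
        simp only [Set.mem_ofPred_eq] at hp hq hr ⊢
        simp [hp, hq, hr] }
  have := Measure.addHaar_affineSubspace (volume : Measure (Fin d → ℝ)) s (fun hs => h (by
    have : x₀ ∈ s := by rw [hs]; trivial
    exact this))
  rw [ae_iff]
  convert! this using 2
  ext x; simp [s]; rfl

lemma ae_ne_zero_coord (d : ℕ) :
    ∀ᵐ x : Fin d → ℝ, (∀ i, x i ≠ 0) ∧ 1 - ∑ i, x i ≠ 0 := by
  refine Filter.Eventually.and (ae_all_iff.2 fun i => ?_) ?_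
  · exact ae_linearMap_ne (LinearMap.proj i) 0 (x₀ := 1) (by simp)
  · filter_upwards [ae_linearMap_ne (∑ i, LinearMap.proj i) 1 (x₀ := (0 : Fin d → ℝ))
      (by simp)] with x hx h
    apply hx
    simp only [LinearMap.coe_sum, Finset.sum_apply, LinearMap.coe_proj, Function.eval]
    linarith

lemma eval_monomialX (α : Fin (d + 1) → ℕ) (x : Fin d → ℝ) :
    polyFun (monomialX α) x =
      (∏ i : Fin d, x i ^ α i.castSucc) * (1 - ∑ i, x i) ^ α (Fin.last d) := by
  simp [polyFun, monomialX, map_prod, map_sum]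

lemma gamma_add_nat {a : ℝ} (ha : 0 < a) (n : ℕ) :
    Real.Gamma (a + n) = poch a n * Real.Gamma a := by
  induction n with
  | zero => simp [poch]
  | succ n ih =>
    rw [poch, ascPochhammer_succ_eval, Nat.cast_succ, ← add_assoc, Real.Gamma_add_one (by positivity),
      ih, poch]
    ring

lemma poch_pos {a : ℝ} (ha : 0 < a) (n : ℕ) : 0 < poch a n := ascPochhammer_pos n a ha

/-- The moments of the Jacobi weight: `X^α W_κ = W_{κ + α}`, so they are quotients of
normalizing constants. -/
theorem integral_monomialX (hκ : ∀ i, -1 < κ i) (α : Fin (d + 1) → ℕ) :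
    jacobiConst κ * ∫ x, polyFun (monomialX α) x ∂jacobiMeasure κ =
      (∏ i, poch (κ i + 1) (α i)) / poch ((∑ i, κ i) + d + 1) (∑ i, α i) := by
  have hκα : ∀ i, -1 < κ i + α i := fun i => by
    have : (0 : ℝ) ≤ α i := by positivity
    linarith [hκ i]
  have h1 : ∫ x, polyFun (monomialX α) x ∂jacobiMeasure κ =
      (jacobiConst fun i => κ i + α i)⁻¹ := by
    have h2 := lintegral_weight hκα
    rw [integral_jacobiMeasure, ← ENNReal.toReal_ofReal (inv_nonneg.2 (jacobiConst_pos hκα).le),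
      ← h2, ← integral_eq_lintegral_of_nonneg_ae
        ((ae_restrict_iff' (measurableSet_simplex d)).2 (.of_forall fun x hx => weight_nonneg _ hx))
        (measurable_weight _).aestronglyMeasurable]
    -- `x ^ (a + n) = x ^ a * x ^ n` for real powers may fail at `x = 0`, so the faces of the simplex
    -- are discarded.
    refine integral_congr_ae (ae_restrict_of_ae ?_)
    filter_upwards [ae_ne_zero_coord d] with x hx
    rw [eval_monomialX, weight, weight, mul_mul_mul_comm, ← Finset.prod_mul_distrib]
    congr 1
    · refine Finset.prod_congr rfl fun i _ => ?_
      rw [Real.rpow_add_natCast (hx.1 i), mul_comm]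
    · rw [Real.rpow_add_natCast hx.2, mul_comm]
  have hσ := sum_add_gt_neg_one hκ
  have hG : ∀ i, Real.Gamma (κ i + α i + 1) = poch (κ i + 1) (α i) * Real.Gamma (κ i + 1) :=
    fun i => by rw [← gamma_add_nat (by linarith [hκ i])]; ring_nf
  have hs : Real.Gamma ((∑ i, (κ i + α i)) + d + 1) = poch ((∑ i, κ i) + d + 1) (∑ i, α i) *
      Real.Gamma ((∑ i, κ i) + d + 1) := by
    rw [← gamma_add_nat (by linarith), Finset.sum_add_distrib]; push_cast; ring_nf
  have hGσ := (Real.Gamma_pos_of_pos (s := (∑ i, κ i) + d + 1) (by linarith)).ne'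
  have hp : ∏ i, Real.Gamma (κ i + 1) ≠ 0 :=
    Finset.prod_ne_zero_iff.2 fun i _ => (Real.Gamma_pos_of_pos (by linarith [hκ i])).ne'
  have hq := (poch_pos (a := (∑ i, κ i) + d + 1) (by linarith) (∑ i, α i)).ne'
  rw [h1, jacobiConst, jacobiConst, hs]
  simp_rw [hG]
  rw [Finset.prod_mul_distrib]
  field_simp

lemma continuous_polyFun (p : MvPolynomial (Fin d) ℝ) : Continuous (polyFun p) :=
  MvPolynomial.continuous_eval p

lemma memLp_of_continuous (hκ : ∀ i, -1 < κ i) {f : (Fin d → ℝ) → ℝ} (hf : Continuous f) :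
    MemLp f 2 (jacobiMeasure κ) := by
  have := isFiniteMeasure_jacobiMeasure hκ
  obtain ⟨C, hC⟩ := (isCompact_simplex d).exists_bound_of_continuousOn hf.continuousOn
  refine MemLp.of_bound hf.aestronglyMeasurable C ?_
  filter_upwards [ae_mem_simplex κ] with x hx using hC x hx

/-- A polynomial vanishing almost everywhere for the Jacobi weight is zero. -/
lemma eq_zero_of_polyFun_ae_eq_zero {p : MvPolynomial (Fin d) ℝ}
    (h : polyFun p =ᵐ[jacobiMeasure κ] 0) : p = 0 := by
  -- The box `(0, 1 / (d + 1))^d` lies in the simplex, and the weight is positive on it.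
  have hd : (0 : ℝ) < 1 / (d + 1) := by positivity
  set U : Set (Fin d → ℝ) := Set.univ.pi fun _ => Set.Ioo 0 (1 / (d + 1 : ℝ)) with hU
  have hUo : IsOpen U := isOpen_set_pi Set.finite_univ fun _ _ => isOpen_Ioo
  have hsum : ∀ x ∈ U, ∑ i, x i < 1 := fun x hx => by
    calc ∑ i, x i ≤ ∑ i : Fin d, (1 / (d + 1) : ℝ) :=
          Finset.sum_le_sum fun i _ => (hx i trivial).2.le
      _ = d / (d + 1) := by simp; ring
      _ < 1 := by rw [div_lt_one (by positivity)]; linarith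
  have hsub : U ⊆ simplex d := fun x hx => ⟨fun i => (hx i trivial).1.le, (hsum x hx).le⟩
  have hae : polyFun p =ᵐ[volume.restrict U] 0 := by
    rw [jacobiMeasure, Filter.EventuallyEq,
      ae_withDensity_iff (measurable_weight κ).ennreal_ofReal] at h
    have h' := ae_mono (Measure.restrict_mono hsub le_rfl) h
    filter_upwards [h', ae_restrict_mem hUo.measurableSet] with x hx hxU
    refine hx ?_
    rw [Ne, ENNReal.ofReal_eq_zero, not_le]
    exact mul_pos (Finset.prod_pos fun i _ => Real.rpow_pos_of_pos (hxU i trivial).1 _)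
      (Real.rpow_pos_of_pos (by linarith [hsum x hxU]) _)
  have heq := Measure.eqOn_open_of_ae_eq hae hUo (continuous_polyFun p).continuousOn
    continuousOn_const
  refine MvPolynomial.funext_set (fun _ => Set.Ioo 0 (1 / (d + 1 : ℝ)))
    (fun _ => Set.Ioo_infinite hd) fun x hx => ?_
  simpa [polyFun] using heq hx

end

/-! ### Expansions in monomials of barycentric coordinates -/

lemma poch_add (a : ℝ) (m n : ℕ) : poch a (m + n) = poch a m * poch (a + m) n := by
  simp only [poch, ← ascPochhammer_mul, Polynomial.eval_mul, Polynomial.eval_comp,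
    Polynomial.eval_add, Polynomial.eval_X, Polynomial.eval_natCast]

/-- As a polynomial in `m`, the Pochhammer symbol `(a + m)_b` is a combination of the falling
factorials of `m` of order at most `b`, and that of order `b` has coefficient `1`. -/
lemma poch_add_natCast_eq_sum_descFactorial (a : ℝ) (b : ℕ) :
    ∃ c : ℕ → ℝ, c b = 1 ∧ (∀ j, b < j → c j = 0) ∧
      ∀ m : ℕ, poch (a + m) b = ∑ j ∈ Finset.range (b + 1), c j * (m.descFactorial j : ℝ) := by
  induction b with
  | zero => exact ⟨fun j => if j = 0 then 1 else 0, by simp, fun j hj => by simp; omega,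
      fun m => by simp [poch]⟩
  | succ b ih =>
    -- The new factor is `a + m + b = (m - j) + (a + b + j)`, and `m - j` raises the order of the
    -- falling factorial from `j` to `j + 1`.
    obtain ⟨c, hcb, hc0, hc⟩ := ih
    let c' : ℕ → ℝ := fun j => (if j = 0 then 0 else c (j - 1)) + (a + b + j) * c j
    refine ⟨c', ?_, fun j hj => ?_, fun m => ?_⟩
    · simp [c', hcb, hc0 (b + 1) (by omega)]
    · have hj0 : j ≠ 0 := by omega
      simp [c', hj0, hc0 j (by omega), hc0 (j - 1) (by omega)]
    · have hstep : ∀ j, (a + m + b) * (c j * (m.descFactorial j : ℝ)) =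
          c j * (m.descFactorial (j + 1) : ℝ) + (a + b + j) * c j * (m.descFactorial j : ℝ) := by
        intro j
        rcases le_or_gt j m with h | h
        · rw [Nat.descFactorial_succ]; push_cast [h]; ring
        · rw [Nat.descFactorial_of_lt h, Nat.descFactorial_of_lt (h.trans (Nat.lt_succ_self j))]
          simp
      have h1 : poch (a + m) (b + 1) = (a + m + b) * poch (a + m) b := by
        rw [poch, ascPochhammer_succ_eval, mul_comm, poch]
      rw [h1, hc, Finset.mul_sum, Finset.sum_congr rfl fun j _ => hstep j, Finset.sum_add_distrib]
      simp only [c', add_mul (if _ = 0 then (0 : ℝ) else _), Finset.sum_add_distrib]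
      congr 1
      · rw [Finset.sum_range_succ' _ (b + 1)]; simp
      · rw [Finset.sum_range_succ _ (b + 1), hc0 (b + 1) (by omega)]; simp

/-- The barycentric coordinates `x_1, …, x_d, 1 - |x|` of the simplex, as polynomials. -/
noncomputable def barycentric {d : ℕ} : Fin (d + 1) → MvPolynomial (Fin d) ℝ :=
  Fin.snoc (fun i => MvPolynomial.X i) (1 - ∑ i : Fin d, MvPolynomial.X i)

section
variable {d : ℕ}

lemma monomialX_eq_prod (α : Fin (d + 1) → ℕ) : monomialX α = ∏ i, barycentric i ^ α i := by
  simp [monomialX, barycentric, Fin.prod_univ_castSucc]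

lemma sum_barycentric : ∑ i : Fin (d + 1), barycentric i = (1 : MvPolynomial (Fin d) ℝ) := by
  simp [barycentric, Fin.sum_univ_castSucc]

lemma monomialX_add (α β : Fin (d + 1) → ℕ) :
    (monomialX (α + β) : MvPolynomial (Fin d) ℝ) = monomialX α * monomialX β := by
  simp [monomialX_eq_prod, pow_add, Finset.prod_mul_distrib]

lemma totalDegree_barycentric_le (i : Fin (d + 1)) :
    (barycentric i : MvPolynomial (Fin d) ℝ).totalDegree ≤ 1 := by
  induction i using Fin.lastCases with
  | cast i => simp [barycentric]
  | last =>
    simp only [barycentric, Fin.snoc_last]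
    refine (MvPolynomial.totalDegree_sub _ _).trans (max_le (by simp) ?_)
    exact MvPolynomial.totalDegree_finsetSum_le fun i _ => by simp

lemma totalDegree_monomialX_le (α : Fin (d + 1) → ℕ) :
    (monomialX α : MvPolynomial (Fin d) ℝ).totalDegree ≤ ∑ i, α i := by
  rw [monomialX_eq_prod]
  refine (MvPolynomial.totalDegree_finsetProd _ _).trans (Finset.sum_le_sum fun i _ => ?_)
  refine (MvPolynomial.totalDegree_pow _ _).trans ?_
  simpa using Nat.mul_le_mul_left (α i) (totalDegree_barycentric_le i)

/-- The polynomials of degree less than `n`, as the span of the `X^γ` with `|γ| < n`; it is zero for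
`n = 0`. -/
noncomputable def polyLT (d n : ℕ) : Submodule ℝ (MvPolynomial (Fin d) ℝ) :=
  Submodule.span ℝ {p | ∃ γ : Fin (d + 1) → ℕ, ∑ i, γ i < n ∧ monomialX γ = p}

lemma monomialX_mem_polyLT {n : ℕ} {γ : Fin (d + 1) → ℕ} (h : ∑ i, γ i < n) :
    monomialX γ ∈ polyLT d n :=
  Submodule.subset_span ⟨γ, h, rfl⟩

lemma polyLT_mono {m n : ℕ} (h : m ≤ n) : polyLT d m ≤ polyLT d n :=
  Submodule.span_mono fun _ ⟨γ, hγ, hp⟩ => ⟨γ, hγ.trans_le h, hp⟩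

lemma polyLT_zero : polyLT d 0 = ⊥ := by simp [polyLT]

lemma mem_polyLT_succ {n : ℕ} {p : MvPolynomial (Fin d) ℝ} :
    p ∈ polyLT d (n + 1) ↔ p.totalDegree ≤ n := by
  constructor
  · intro h
    rw [← MvPolynomial.mem_restrictTotalDegree]
    refine Submodule.span_le.2 ?_ h
    rintro _ ⟨γ, hγ, rfl⟩
    rw [SetLike.mem_coe, MvPolynomial.mem_restrictTotalDegree]
    exact (totalDegree_monomialX_le γ).trans (Nat.lt_succ_iff.1 hγ)
  · intro h
    rw [p.as_sum]
    refine Submodule.sum_mem _ fun s hs => ?_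
    have he : MvPolynomial.monomial s (p.coeff s) =
        p.coeff s • (monomialX (Fin.snoc s 0) : MvPolynomial (Fin d) ℝ) := by
      rw [MvPolynomial.monomial_eq, MvPolynomial.smul_eq_C_mul, Finsupp.prod_fintype _ _ (by simp)]
      simp [monomialX]
    rw [he]
    refine Submodule.smul_mem _ _ (monomialX_mem_polyLT ?_)
    have := (MvPolynomial.le_totalDegree hs).trans h
    rw [Finsupp.sum_fintype _ _ (by simp)] at this
    simpa [Fin.sum_univ_castSucc] using Nat.lt_succ_iff.2 this

lemma totalDegree_lt_of_mem_polyLT {n : ℕ} {p : MvPolynomial (Fin d) ℝ} (hn : 0 < n)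
    (h : p ∈ polyLT d n) : p.totalDegree < n := by
  obtain ⟨m, rfl⟩ := Nat.exists_eq_succ_of_ne_zero hn.ne'
  exact Nat.lt_succ_iff.2 (mem_polyLT_succ.1 h)

lemma mem_polyLT_of_totalDegree_lt {n : ℕ} {p : MvPolynomial (Fin d) ℝ} (h : p.totalDegree < n) :
    p ∈ polyLT d n :=
  polyLT_mono (Nat.succ_le_of_lt h) (mem_polyLT_succ.2 le_rfl)

instance (n : ℕ) : FiniteDimensional ℝ (polyLT d n) := by
  refine FiniteDimensional.span_of_finite ℝ (Set.Finite.subset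
    (((Set.finite_Iic (fun _ : Fin (d + 1) => n)).image monomialX)) ?_)
  rintro _ ⟨γ, hγ, rfl⟩
  exact ⟨γ, fun i => ((Finset.single_le_sum (fun j _ => Nat.zero_le (γ j))
    (Finset.mem_univ i)).trans hγ.le), rfl⟩

/-- The multinomial theorem for barycentric coordinates, whose sum is `1`. -/
lemma sum_monomialX_div_factorial (M : ℕ) :
    ∑ α ∈ Finset.piAntidiag (Finset.univ : Finset (Fin (d + 1))) M,
      (∏ i, ((α i).factorial : ℝ))⁻¹ • (monomialX α : MvPolynomial (Fin d) ℝ) =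
        ((M.factorial : ℝ)⁻¹) • 1 := by
  have h := Finset.sum_pow_eq_sum_piAntidiag (Finset.univ : Finset (Fin (d + 1)))
    (barycentric (d := d)) M
  rw [sum_barycentric, one_pow] at h
  rw [h, Finset.smul_sum]
  refine Finset.sum_congr rfl fun α hα => ?_
  have hm := Nat.multinomial_spec (Finset.univ : Finset (Fin (d + 1))) α
  rw [(Finset.mem_piAntidiag.1 hα).1] at hm
  have hm' : (∏ i, ((α i).factorial : ℝ)) * (Nat.multinomial Finset.univ α : ℝ) = M.factorial := by
    exact_mod_cast hm
  have hpos : (∏ i, ((α i).factorial : ℝ)) ≠ 0 :=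
    Finset.prod_ne_zero_iff.2 fun i _ => by positivity
  rw [monomialX_eq_prod, ← nsmul_eq_mul, ← Nat.cast_smul_eq_nsmul ℝ, smul_smul]
  congr 1
  rw [← hm']
  have : (Nat.multinomial Finset.univ α : ℝ) ≠ 0 := by
    exact_mod_cast (Nat.multinomial_pos _ _).ne'
  field_simp

/-- The term of index `α` vanishes unless `γ ≤ α`, and the remaining terms are `X^γ` times those of
the multinomial theorem for `α - γ`. -/
lemma sum_descFactorial_smul_monomialX {N : ℕ} (γ : Fin (d + 1) → ℕ) (hγ : ∑ i, γ i ≤ N) :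
    ∑ α ∈ Finset.piAntidiag (Finset.univ : Finset (Fin (d + 1))) N,
      ((∏ i, ((α i).descFactorial (γ i) : ℝ)) * (∏ i, ((α i).factorial : ℝ))⁻¹) •
        (monomialX α : MvPolynomial (Fin d) ℝ) =
      (((N - ∑ i, γ i).factorial : ℝ)⁻¹) • monomialX γ := by
  classical
  have himg : (Finset.piAntidiag Finset.univ (N - ∑ i, γ i)).image (fun α => γ + α) ⊆
      Finset.piAntidiag (Finset.univ : Finset (Fin (d + 1))) N := by
    intro α hα
    obtain ⟨α', hα', rfl⟩ := Finset.mem_image.1 hα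
    have : ∑ i, α' i = N - ∑ i, γ i := (Finset.mem_piAntidiag.1 hα').1
    simp only [Finset.mem_piAntidiag, Pi.add_apply, Finset.sum_add_distrib]
    exact ⟨by omega, fun _ _ => Finset.mem_univ _⟩
  rw [← Finset.sum_subset himg, Finset.sum_image fun _ _ _ _ h => add_left_cancel h,
    ← mul_one (monomialX γ), ← mul_smul_comm, ← sum_monomialX_div_factorial, Finset.mul_sum]
  · refine Finset.sum_congr rfl fun α _ => ?_
    rw [monomialX_add, mul_smul_comm]
    congr 1
    rw [← Finset.prod_inv_distrib, ← Finset.prod_inv_distrib, ← Finset.prod_mul_distrib]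
    refine Finset.prod_congr rfl fun i _ => ?_
    have h := Nat.factorial_mul_descFactorial (Nat.le_add_right (γ i) (α i))
    rw [Nat.add_sub_cancel_left] at h
    have h' : ((α i).factorial : ℝ) * ((γ i + α i).descFactorial (γ i) : ℝ) =
      ((γ i + α i).factorial : ℝ) := by exact_mod_cast h
    rw [Pi.add_apply, ← h']
    have h1 : ((α i).factorial : ℝ) ≠ 0 := by positivity
    have h2 : ((γ i + α i).descFactorial (γ i) : ℝ) ≠ 0 := by
      exact_mod_cast (Nat.descFactorial_pos.2 (Nat.le_add_right _ _)).ne'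
    field_simp
  · intro α hα hα'
    obtain ⟨i, hi⟩ : ∃ i, α i < γ i := by
      by_contra! hle
      refine hα' (Finset.mem_image.2 ⟨α - γ, ?_, add_tsub_cancel_of_le hle⟩)
      have h1 := (Finset.mem_piAntidiag.1 hα).1
      refine Finset.mem_piAntidiag.2 ⟨?_, fun _ _ => Finset.mem_univ _⟩
      rw [← h1, ← Finset.sum_tsub_distrib _ fun i _ => hle i]
      rfl
    rw [Finset.prod_eq_zero (Finset.mem_univ i) (by simp [Nat.descFactorial_of_lt hi]), zero_mul,
      zero_smul]

/-- The Durrmeyer-type operator with Jacobi moments maps `X^β` to a multiple of `X^β`, up to terms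
of lower degree: `(κ + 1 + α)_β` is expanded in falling factorials of `α`, and the sum over `α`
of each of them is given by the multinomial theorem. -/
lemma sum_poch_smul_monomialX_sub_mem_polyLT (κ : Fin (d + 1) → ℝ) {N : ℕ} (β : Fin (d + 1) → ℕ)
    (hβ : ∑ i, β i ≤ N) :
    ∑ α ∈ Finset.piAntidiag (Finset.univ : Finset (Fin (d + 1))) N,
      ((∏ i, poch (κ i + 1 + α i) (β i)) * (∏ i, ((α i).factorial : ℝ))⁻¹) •
        (monomialX α : MvPolynomial (Fin d) ℝ) -
      (((N - ∑ i, β i).factorial : ℝ)⁻¹) • monomialX β ∈ polyLT d (∑ i, β i) := by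
  choose c hc1 hc0 hc using fun i => poch_add_natCast_eq_sum_descFactorial (κ i + 1) (β i)
  set G := Fintype.piFinset fun i => Finset.range (β i + 1) with hG
  have hGβ : β ∈ G := by simp [hG]
  have hle : ∀ γ ∈ G, ∀ i, γ i ≤ β i := fun γ hγ i =>
    Nat.lt_succ_iff.1 (Finset.mem_range.1 (Fintype.mem_piFinset.1 hγ i))
  have hexp : ∑ α ∈ Finset.piAntidiag (Finset.univ : Finset (Fin (d + 1))) N,
      ((∏ i, poch (κ i + 1 + α i) (β i)) * (∏ i, ((α i).factorial : ℝ))⁻¹) •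
        (monomialX α : MvPolynomial (Fin d) ℝ) =
      ∑ γ ∈ G, (∏ i, c i (γ i)) • (((N - ∑ i, γ i).factorial : ℝ)⁻¹) •
        (monomialX γ : MvPolynomial (Fin d) ℝ) := by
    have h1 : ∀ γ ∈ G, (∏ i, c i (γ i)) • (((N - ∑ i, γ i).factorial : ℝ)⁻¹) •
        (monomialX γ : MvPolynomial (Fin d) ℝ) =
        ∑ α ∈ Finset.piAntidiag (Finset.univ : Finset (Fin (d + 1))) N, (∏ i, c i (γ i)) •
          ((∏ i, ((α i).descFactorial (γ i) : ℝ)) * (∏ i, ((α i).factorial : ℝ))⁻¹) •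
            (monomialX α : MvPolynomial (Fin d) ℝ) := fun γ hγ => by
      rw [← sum_descFactorial_smul_monomialX γ
        ((Finset.sum_le_sum fun i _ => hle γ hγ i).trans hβ), Finset.smul_sum]
    rw [Finset.sum_congr rfl h1, Finset.sum_comm]
    refine Finset.sum_congr rfl fun α _ => ?_
    simp_rw [smul_smul]
    rw [← Finset.sum_smul]
    congr 1
    simp_rw [hc, ← mul_assoc, ← Finset.sum_mul, ← Finset.prod_mul_distrib]
    rw [Finset.prod_univ_sum]
  -- The term `γ = β` is the multiple of `X^β`; the others have `γ ≤ β` and `γ ≠ β`.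
  rw [hexp, ← Finset.add_sum_erase _ _ hGβ, Finset.prod_congr rfl fun i _ => hc1 i]
  rw [Finset.prod_const_one, one_smul, add_sub_cancel_left]
  refine Submodule.sum_mem _ fun γ hγ => Submodule.smul_mem _ _ (Submodule.smul_mem _ _
    (monomialX_mem_polyLT ?_))
  obtain ⟨hne, hγG⟩ := Finset.mem_erase.1 hγ
  obtain ⟨i, hi⟩ := Function.ne_iff.1 hne
  exact Finset.sum_lt_sum (fun j _ => hle γ hγG j)
    ⟨i, Finset.mem_univ i, lt_of_le_of_ne (hle γ hγG i) hi⟩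

end

/-! ### Orthogonal polynomials and orthogonal projections -/

section
variable {d : ℕ} {κ : Fin (d + 1) → ℝ}

lemma memLp_polyFun (hκ : ∀ i, -1 < κ i) (p : MvPolynomial (Fin d) ℝ) :
    MemLp (polyFun p) 2 (jacobiMeasure κ) :=
  memLp_of_continuous hκ (continuous_polyFun p)

/-- Polynomials as elements of `L²(T^d, W_κ)`. -/
noncomputable def polyToLp (hκ : ∀ i, -1 < κ i) :
    MvPolynomial (Fin d) ℝ →ₗ[ℝ] Lp ℝ 2 (jacobiMeasure κ) where
  toFun p := (memLp_polyFun hκ p).toLp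
  map_add' p q := by
    rw [← MemLp.toLp_add]
    exact MemLp.toLp_congr _ _ (.of_forall fun x => by simp [polyFun])
  map_smul' a p := by
    rw [RingHom.id_apply, ← MemLp.toLp_const_smul]
    exact MemLp.toLp_congr _ _ (.of_forall fun x => by simp [polyFun])

lemma inner_eq_inner_toLp {f g : (Fin d → ℝ) → ℝ} (hf : MemLp f 2 (jacobiMeasure κ))
    (hg : MemLp g 2 (jacobiMeasure κ)) :
    inner κ f g = jacobiConst κ * Inner.inner ℝ hf.toLp hg.toLp := by
  rw [inner_eq_integral, L2.inner_def]
  congr 1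
  refine integral_congr_ae ?_
  filter_upwards [hf.coeFn_toLp, hg.coeFn_toLp] with x hx hy
  rw [hx, hy]
  simp [mul_comm]

/-- The inner product of polynomials as a bilinear form. -/
noncomputable def jacobiForm (hκ : ∀ i, -1 < κ i) :
    LinearMap.BilinForm ℝ (MvPolynomial (Fin d) ℝ) :=
  jacobiConst κ • (innerₗ (Lp ℝ 2 (jacobiMeasure κ))).compl₁₂ (polyToLp hκ) (polyToLp hκ)

lemma jacobiForm_apply (hκ : ∀ i, -1 < κ i) (p q : MvPolynomial (Fin d) ℝ) :
    jacobiForm hκ p q = jacobiConst κ * Inner.inner ℝ (polyToLp hκ p) (polyToLp hκ q) := by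
  simp [jacobiForm]

lemma inner_polyFun (hκ : ∀ i, -1 < κ i) (p q : MvPolynomial (Fin d) ℝ) :
    inner κ (polyFun p) (polyFun q) = jacobiForm hκ p q := by
  rw [jacobiForm_apply, inner_eq_inner_toLp (memLp_polyFun hκ p) (memLp_polyFun hκ q)]
  rfl

lemma jacobiForm_comm (hκ : ∀ i, -1 < κ i) (p q : MvPolynomial (Fin d) ℝ) :
    jacobiForm hκ p q = jacobiForm hκ q p := by
  rw [jacobiForm_apply, jacobiForm_apply, real_inner_comm]

lemma polyToLp_injective (hκ : ∀ i, -1 < κ i) : Function.Injective (polyToLp hκ) := by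
  rw [← LinearMap.ker_eq_bot, LinearMap.ker_eq_bot']
  intro p hp
  refine eq_zero_of_polyFun_ae_eq_zero (κ := κ) ?_
  exact (memLp_polyFun hκ p).coeFn_toLp.symm.trans ((Lp.ext_iff.1 hp).trans (Lp.coeFn_zero _ _ _))

lemma eq_zero_of_jacobiForm_self (hκ : ∀ i, -1 < κ i) {p : MvPolynomial (Fin d) ℝ}
    (h : jacobiForm hκ p p = 0) : p = 0 := by
  rw [jacobiForm_apply] at h
  have h0 := (mul_eq_zero.1 h).resolve_left (jacobiConst_pos hκ).ne'
  exact polyToLp_injective hκ (by rw [inner_self_eq_zero.1 h0, map_zero])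

lemma jacobiForm_monomialX (hκ : ∀ i, -1 < κ i) (α β : Fin (d + 1) → ℕ) :
    jacobiForm hκ (monomialX α) (monomialX β) =
      (∏ i, poch (κ i + 1) (α i + β i)) / poch ((∑ i, κ i) + d + 1) (∑ i, (α i + β i)) := by
  rw [← inner_polyFun, inner_eq_integral]
  have h := integral_monomialX hκ (α + β)
  simp only [Pi.add_apply] at h
  rw [← h, monomialX_add]
  simp [polyFun]

/-- `V_n^d(W_κ)` as a linear subspace. -/
noncomputable def orthSubmodule (hκ : ∀ i, -1 < κ i) (n : ℕ) :
    Submodule ℝ (MvPolynomial (Fin d) ℝ) :=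
  polyLT d (n + 1) ⊓ (polyLT d n).orthogonalBilin (jacobiForm hκ)

lemma mem_orthSubmodule (hκ : ∀ i, -1 < κ i) {n : ℕ} {p : MvPolynomial (Fin d) ℝ} :
    p ∈ orthSubmodule hκ n ↔
      p ∈ polyLT d (n + 1) ∧ ∀ q ∈ polyLT d n, jacobiForm hκ q p = 0 := Iff.rfl

lemma mem_orthPolys (hκ : ∀ i, -1 < κ i) {n : ℕ} {p : MvPolynomial (Fin d) ℝ} :
    p ∈ orthPolys κ n ↔ p ∈ orthSubmodule hκ n := by
  rw [mem_orthSubmodule, mem_polyLT_succ]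
  refine and_congr_right fun _ => ⟨fun h q hq => ?_, fun h q hq => ?_⟩
  · rcases n.eq_zero_or_pos with rfl | hn
    · rw [polyLT_zero, Submodule.mem_bot] at hq
      simp [hq]
    · rw [jacobiForm_comm, ← inner_polyFun]
      exact h q (totalDegree_lt_of_mem_polyLT hn hq)
  · rw [inner_polyFun hκ, jacobiForm_comm]
    exact h q (mem_polyLT_of_totalDegree_lt hq)

instance (hκ : ∀ i, -1 < κ i) (n : ℕ) : FiniteDimensional ℝ (orthSubmodule hκ n) :=
  Submodule.finiteDimensional_of_le inf_le_left

/-- Every element of `L²(T^d, W_κ)` has an orthogonal projection onto a finite-dimensional space of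
polynomials. -/
lemma exists_inner_sub_polyToLp_eq_zero (hκ : ∀ i, -1 < κ i)
    (V : Submodule ℝ (MvPolynomial (Fin d) ℝ)) [FiniteDimensional ℝ V]
    (h : Lp ℝ 2 (jacobiMeasure κ)) :
    ∃ r ∈ V, ∀ q ∈ V, Inner.inner ℝ (h - polyToLp hκ r) (polyToLp hκ q) = 0 := by
  obtain ⟨r, hr, hr'⟩ := (V.map (polyToLp hκ)).starProjection_apply_mem h
  refine ⟨r, hr, fun q hq => ?_⟩
  rw [hr']
  exact Submodule.starProjection_inner_eq_zero h _ ⟨q, hq, rfl⟩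

lemma isOrthProj_iff (hκ : ∀ i, -1 < κ i) {n : ℕ} {p r : MvPolynomial (Fin d) ℝ} :
    IsOrthProj κ n p r ↔ r ∈ orthSubmodule hκ n ∧
      ∀ q ∈ orthSubmodule hκ n, jacobiForm hκ p q = jacobiForm hκ r q := by
  simp only [IsOrthProj, mem_orthPolys hκ, inner_polyFun hκ, map_sub, LinearMap.sub_apply,
    sub_eq_zero]

lemma eq_of_forall_jacobiForm_eq (hκ : ∀ i, -1 < κ i) {V : Submodule ℝ (MvPolynomial (Fin d) ℝ)}
    {r s : MvPolynomial (Fin d) ℝ} (hr : r ∈ V) (hs : s ∈ V)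
    (h : ∀ q ∈ V, jacobiForm hκ r q = jacobiForm hκ s q) : r = s := by
  refine sub_eq_zero.1 (eq_zero_of_jacobiForm_self hκ ?_)
  rw [LinearMap.map_sub₂, h _ (V.sub_mem hr hs), sub_self]

lemma existsUnique_isOrthProj (hκ : ∀ i, -1 < κ i) (n : ℕ) (p : MvPolynomial (Fin d) ℝ) :
    ∃! r, IsOrthProj κ n p r := by
  simp only [isOrthProj_iff hκ]
  obtain ⟨r, hr, h⟩ := exists_inner_sub_polyToLp_eq_zero hκ (orthSubmodule hκ n) (polyToLp hκ p)
  have hpr : ∀ q ∈ orthSubmodule hκ n, jacobiForm hκ p q = jacobiForm hκ r q := fun q hq => by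
    have hq' := h q hq
    rw [inner_sub_left, sub_eq_zero] at hq'
    rw [jacobiForm_apply, jacobiForm_apply, hq']
  exact ⟨r, ⟨hr, hpr⟩, fun s hs => eq_of_forall_jacobiForm_eq hκ hs.1 hr fun q hq => by
    rw [← hs.2 q hq, hpr q hq]⟩

lemma orthProj_mem (hκ : ∀ i, -1 < κ i) (n : ℕ) (p : MvPolynomial (Fin d) ℝ) :
    orthProj κ n p ∈ orthSubmodule hκ n :=
  ((isOrthProj_iff hκ).1 (Classical.epsilon_spec (existsUnique_isOrthProj hκ n p).exists)).1

lemma jacobiForm_orthProj (hκ : ∀ i, -1 < κ i) {n : ℕ} (p : MvPolynomial (Fin d) ℝ)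
    {q : MvPolynomial (Fin d) ℝ} (hq : q ∈ orthSubmodule hκ n) :
    jacobiForm hκ (orthProj κ n p) q = jacobiForm hκ p q :=
  (((isOrthProj_iff hκ).1
    (Classical.epsilon_spec (existsUnique_isOrthProj hκ n p).exists)).2 q hq).symm

/-! ### The Durrmeyer-type operator -/

lemma frameWeight_pos (hκ : ∀ i, -1 < κ i) (α : Fin (d + 1) → ℕ) : 0 < frameWeight κ α :=
  mul_pos (Finset.prod_pos fun i _ => poch_pos (by linarith [hκ i]) _)
    (Finset.prod_pos fun i _ => by positivity)

lemma frameConst_eq (κ : Fin (d + 1) → ℝ) {n N : ℕ} (h : n ≤ N) :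
    frameConst κ n N = poch ((∑ i, κ i) + d + 1) (N + n) * ((N - n).factorial : ℝ) := by
  have h1 : (-1 : ℝ) ^ n * poch (-(N : ℝ)) n = (N.descFactorial n : ℝ) := by
    rw [poch, ascPochhammer_eval_neg_eq_descPochhammer, ← mul_assoc, ← mul_pow,
      descPochhammer_eval_eq_descFactorial]
    simp
  have h2 : (N.factorial : ℝ) = ((N - n).factorial : ℝ) * (N.descFactorial n : ℝ) := by
    exact_mod_cast (Nat.factorial_mul_descFactorial h).symm
  have h3 : (N.descFactorial n : ℝ) ≠ 0 := by exact_mod_cast (Nat.descFactorial_pos.2 h).ne'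
  rw [frameConst, h1, h2]
  field_simp

lemma frameConst_pos (hκ : ∀ i, -1 < κ i) {n N : ℕ} (h : n ≤ N) : 0 < frameConst κ n N := by
  rw [frameConst_eq κ h]
  exact mul_pos (poch_pos (by linarith [sum_add_gt_neg_one hκ]) _) (by positivity)

/-- The Durrmeyer-type operator `p ↦ ∑_{|α| = N} ⟨p, X^α⟩ X^α / ((κ + 1)_α α!)`. -/
noncomputable def durrmeyer (hκ : ∀ i, -1 < κ i) (N : ℕ) :
    MvPolynomial (Fin d) ℝ →ₗ[ℝ] MvPolynomial (Fin d) ℝ :=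
  ∑ α ∈ Finset.piAntidiag (Finset.univ : Finset (Fin (d + 1))) N,
    (frameWeight κ α)⁻¹ • ((jacobiForm hκ).flip (monomialX α)).smulRight (monomialX α)

lemma durrmeyer_apply (hκ : ∀ i, -1 < κ i) (N : ℕ) (p : MvPolynomial (Fin d) ℝ) :
    durrmeyer hκ N p = ∑ α ∈ Finset.piAntidiag (Finset.univ : Finset (Fin (d + 1))) N,
      (frameWeight κ α)⁻¹ • jacobiForm hκ p (monomialX α) • monomialX α := by
  simp [durrmeyer, LinearMap.sum_apply]

lemma jacobiForm_durrmeyer (hκ : ∀ i, -1 < κ i) (N : ℕ) (p q : MvPolynomial (Fin d) ℝ) :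
    jacobiForm hκ (durrmeyer hκ N p) q =
      ∑ α ∈ Finset.piAntidiag (Finset.univ : Finset (Fin (d + 1))) N,
        (frameWeight κ α)⁻¹ * (jacobiForm hκ p (monomialX α) * jacobiForm hκ q (monomialX α)) := by
  simp [durrmeyer_apply, LinearMap.sum_apply, jacobiForm_comm hκ q]

lemma jacobiForm_durrmeyer_comm (hκ : ∀ i, -1 < κ i) (N : ℕ) (p q : MvPolynomial (Fin d) ℝ) :
    jacobiForm hκ (durrmeyer hκ N p) q = jacobiForm hκ (durrmeyer hκ N q) p := by
  rw [jacobiForm_durrmeyer, jacobiForm_durrmeyer]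
  exact Finset.sum_congr rfl fun α _ => by ring

lemma durrmeyer_monomialX_sub_mem_polyLT (hκ : ∀ i, -1 < κ i) {N : ℕ} (β : Fin (d + 1) → ℕ)
    (hβ : ∑ i, β i ≤ N) :
    durrmeyer hκ N (monomialX β) - (frameConst κ (∑ i, β i) N)⁻¹ • monomialX β ∈
      polyLT d (∑ i, β i) := by
  have h := Submodule.smul_mem _ (poch ((∑ i, κ i) + d + 1) (N + ∑ i, β i))⁻¹
    (sum_poch_smul_monomialX_sub_mem_polyLT κ β hβ)
  convert! h using 1
  rw [smul_sub, smul_smul, frameConst_eq κ hβ, mul_inv, durrmeyer_apply, Finset.smul_sum]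
  congr 1
  refine Finset.sum_congr rfl fun α hα => ?_
  have hα' : ∑ i, α i = N := (Finset.mem_piAntidiag.1 hα).1
  rw [smul_smul, smul_smul, jacobiForm_comm, jacobiForm_monomialX, Finset.sum_add_distrib, hα',
    frameWeight]
  simp_rw [poch_add]
  rw [Finset.prod_mul_distrib]
  have h1 : ∏ i, poch (κ i + 1) (α i) ≠ 0 :=
    Finset.prod_ne_zero_iff.2 fun i _ => (poch_pos (by linarith [hκ i]) _).ne'
  congr 1
  field_simp

lemma durrmeyer_sub_mem_polyLT (hκ : ∀ i, -1 < κ i) {n N : ℕ} (hn : n ≤ N)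
    {p : MvPolynomial (Fin d) ℝ} (hp : p ∈ polyLT d (n + 1)) :
    durrmeyer hκ N p - (frameConst κ n N)⁻¹ • p ∈ polyLT d n := by
  suffices h : polyLT d (n + 1) ≤ (polyLT d n).comap
      (durrmeyer hκ N - (frameConst κ n N)⁻¹ • LinearMap.id) from h hp
  refine Submodule.span_le.2 ?_
  rintro _ ⟨β, hβ, rfl⟩
  change durrmeyer hκ N (monomialX β) - (frameConst κ n N)⁻¹ • monomialX β ∈ polyLT d n
  have h := durrmeyer_monomialX_sub_mem_polyLT hκ β ((Nat.lt_succ_iff.1 hβ).trans hn)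
  rcases (Nat.lt_succ_iff.1 hβ).eq_or_lt with he | hlt
  · rwa [he] at h
  · have hβn := monomialX_mem_polyLT hlt
    refine Submodule.sub_mem _ ?_ (Submodule.smul_mem _ _ hβn)
    rw [← sub_add_cancel (durrmeyer hκ N (monomialX β))
      ((frameConst κ (∑ i, β i) N)⁻¹ • monomialX β)]
    exact Submodule.add_mem _ (polyLT_mono hlt.le h) (Submodule.smul_mem _ _ hβn)

/-- On `V_n^d(W_κ)` the Durrmeyer-type operator is the multiplication by `1 / C_{n,N}`: it is
self-adjoint and lowers degrees up to that multiple. -/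
theorem durrmeyer_eq_smul (hκ : ∀ i, -1 < κ i) {n N : ℕ} (hn : n ≤ N)
    {p : MvPolynomial (Fin d) ℝ} (hp : p ∈ orthSubmodule hκ n) :
    durrmeyer hκ N p = (frameConst κ n N)⁻¹ • p := by
  -- The difference `r` of both sides has degree less than `n`, and `⟨r, r⟩ = 0` because both
  -- `⟨T p, r⟩ = ⟨p, T r⟩` and `⟨p, r⟩` vanish.
  have hr := durrmeyer_sub_mem_polyLT hκ hn hp.1
  refine sub_eq_zero.1 (eq_zero_of_jacobiForm_self hκ ?_)
  have hlow : ∀ q ∈ polyLT d n, durrmeyer hκ N q ∈ polyLT d n := fun q hq => by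
    rcases n.eq_zero_or_pos with rfl | hpos
    · rw [polyLT_zero, Submodule.mem_bot] at hq ⊢
      rw [hq, map_zero]
    · have h := durrmeyer_sub_mem_polyLT hκ hn (polyLT_mono n.le_succ hq)
      simpa using Submodule.add_mem _ h (Submodule.smul_mem _ (frameConst κ n N)⁻¹ hq)
  set r := durrmeyer hκ N p - (frameConst κ n N)⁻¹ • p with hrdef
  have hsplit : jacobiForm hκ r r =
      jacobiForm hκ (durrmeyer hκ N p) r - (frameConst κ n N)⁻¹ * jacobiForm hκ p r := by
    nth_rw 1 [hrdef]
    rw [LinearMap.map_sub₂, LinearMap.map_smul₂, smul_eq_mul]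
  rw [hsplit, jacobiForm_durrmeyer_comm, hp.2 _ (hlow r hr), jacobiForm_comm hκ p, hp.2 r hr,
    mul_zero, sub_zero]

/-- The tight frame identity on `V_n^d(W_κ)` in polarized form. -/
theorem sum_jacobiForm_mul_jacobiForm (hκ : ∀ i, -1 < κ i) {n N : ℕ} (hn : n ≤ N)
    {p q : MvPolynomial (Fin d) ℝ} (hp : p ∈ orthSubmodule hκ n) (hq : q ∈ orthSubmodule hκ n) :
    frameConst κ n N * ∑ α ∈ Finset.piAntidiag (Finset.univ : Finset (Fin (d + 1))) N,
      (frameWeight κ α)⁻¹ * (jacobiForm hκ p (orthProj κ n (monomialX α)) *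
        jacobiForm hκ q (orthProj κ n (monomialX α))) = jacobiForm hκ p q := by
  have h := jacobiForm_durrmeyer hκ N p q
  rw [durrmeyer_eq_smul hκ hn hp, map_smul, LinearMap.smul_apply, smul_eq_mul] at h
  have hproj : ∀ s ∈ orthSubmodule hκ n, ∀ α, jacobiForm hκ s (orthProj κ n (monomialX α)) =
      jacobiForm hκ s (monomialX α) := fun s hs α => by
    rw [jacobiForm_comm, jacobiForm_orthProj hκ _ hs, jacobiForm_comm]
  simp_rw [hproj p hp, hproj q hq]
  rw [← h, mul_inv_cancel_left₀ (frameConst_pos hκ hn).ne']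

/-- The reproducing property in terms of polynomials. -/
theorem sum_jacobiForm_smul_orthProj (hκ : ∀ i, -1 < κ i) {n N : ℕ} (hn : n ≤ N)
    {p : MvPolynomial (Fin d) ℝ} (hp : p ∈ orthSubmodule hκ n) :
    frameConst κ n N • ∑ α ∈ Finset.piAntidiag (Finset.univ : Finset (Fin (d + 1))) N,
      ((frameWeight κ α)⁻¹ * jacobiForm hκ p (orthProj κ n (monomialX α))) •
        orthProj κ n (monomialX α) = p := by
  refine eq_of_forall_jacobiForm_eq hκ (V := orthSubmodule hκ n) (Submodule.smul_mem _ _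
    (Submodule.sum_mem _ fun α _ => Submodule.smul_mem _ _ (orthProj_mem hκ n _))) hp fun q hq => ?_
  rw [← sum_jacobiForm_mul_jacobiForm hκ hn hp hq]
  simp [LinearMap.sum_apply, jacobiForm_comm hκ q, mul_assoc]

end

section
variable {d : ℕ} {κ : Fin (d + 1) → ℝ}

/-! ### Density of polynomials and the orthogonal expansion -/

/-- Stone–Weierstrass for polynomials in several variables on a compact set. -/
lemma exists_polyFun_near {K : Set (Fin d → ℝ)} (hK : IsCompact K) {g : (Fin d → ℝ) → ℝ}
    (hg : Continuous g) {ε : ℝ} (hε : 0 < ε) :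
    ∃ p : MvPolynomial (Fin d) ℝ, ∀ x ∈ K, ‖polyFun p x - g x‖ < ε := by
  let φ : MvPolynomial (Fin d) ℝ →ₐ[ℝ] C(Fin d → ℝ, ℝ) :=
    MvPolynomial.aeval fun i => ⟨fun x => x i, continuous_apply i⟩
  have hφ : ∀ p x, φ p x = polyFun p x := fun p x => by
    have : (ContinuousMap.evalAlgHom ℝ ℝ x).comp φ = MvPolynomial.aeval x :=
      MvPolynomial.algHom_ext fun i => by simp [φ]
    exact (DFunLike.congr_fun this p).trans (by simp [polyFun, MvPolynomial.aeval_eq_eval])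
  have hsep : φ.range.SeparatesPoints := fun x y hxy => by
    obtain ⟨i, hi⟩ := Function.ne_iff.1 hxy
    exact ⟨_, ⟨φ (MvPolynomial.X i), ⟨_, rfl⟩, rfl⟩, by simpa [hφ, polyFun] using hi⟩
  obtain ⟨_, ⟨p, rfl⟩, hp⟩ :=
    ContinuousMap.exists_mem_subalgebra_near_continuous_of_isCompact_of_separatesPoints hsep
      ⟨g, hg⟩ hK hε
  exact ⟨p, fun x hx => by simpa [hφ] using hp x hx⟩

/-- Polynomials are dense in `L²(T^d, W_κ)`. -/
lemma topologicalClosure_range_polyToLp (hκ : ∀ i, -1 < κ i) :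
    (LinearMap.range (polyToLp hκ)).topologicalClosure = ⊤ := by
  have := isFiniteMeasure_jacobiMeasure hκ
  rw [eq_top_iff]
  intro f _
  have hdense := BoundedContinuousFunction.toLp_denseRange (μ := jacobiMeasure κ) (𝕜 := ℝ) (E := ℝ)
    (p := 2) (by simp)
  refine (isClosed_closure.closure_subset_iff.2 ?_) (hdense f)
  rintro _ ⟨g, rfl⟩
  refine Metric.mem_closure_iff.2 fun ε hε => ?_
  set M : ℝ := (measureUnivNNReal (jacobiMeasure κ) : ℝ) ^ ((2 : ENNReal).toReal)⁻¹ with hM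
  have hM0 : 0 ≤ M := by positivity
  obtain ⟨p, hp⟩ := exists_polyFun_near (isCompact_simplex d) g.continuous
    (ε := ε / (M + 1)) (by positivity)
  refine ⟨polyToLp hκ p, ⟨p, rfl⟩, ?_⟩
  rw [dist_comm, dist_eq_norm]
  have hbound : ‖polyToLp hκ p - BoundedContinuousFunction.toLp 2 (jacobiMeasure κ) ℝ g‖ ≤
      M * (ε / (M + 1)) := by
    refine Lp.norm_le_of_ae_bound (by positivity) ?_
    filter_upwards [ae_mem_simplex κ, (memLp_polyFun hκ p).coeFn_toLp,
      BoundedContinuousFunction.coeFn_toLp 2 (jacobiMeasure κ) ℝ g,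
      Lp.coeFn_sub (polyToLp hκ p) (BoundedContinuousFunction.toLp 2 (jacobiMeasure κ) ℝ g)]
      with x hx h1 h2 h3
    rw [h3, Pi.sub_apply, h2]
    change ‖(memLp_polyFun hκ p).toLp (polyFun p) x - g x‖ ≤ _
    rw [h1]
    exact (hp x hx).le
  refine hbound.trans_lt ?_
  rw [mul_div_assoc', div_lt_iff₀ (by positivity)]
  nlinarith

/-- Every polynomial is a sum of orthogonal polynomials: subtract from it its projection onto the
polynomials of lower degree. -/
lemma polyLT_le_iSup_orthSubmodule (hκ : ∀ i, -1 < κ i) (n : ℕ) :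
    polyLT d n ≤ ⨆ k, orthSubmodule hκ k := by
  induction n with
  | zero => simp [polyLT_zero]
  | succ n ih =>
    intro p hp
    obtain ⟨s, hs, h⟩ := exists_inner_sub_polyToLp_eq_zero hκ (polyLT d n) (polyToLp hκ p)
    have hps : p - s ∈ orthSubmodule hκ n := by
      refine (mem_orthSubmodule hκ).2 ⟨Submodule.sub_mem _ hp (polyLT_mono n.le_succ hs),
        fun q hq => ?_⟩
      rw [jacobiForm_comm, jacobiForm_apply, map_sub, h q hq, mul_zero]
    rw [← sub_add_cancel p s]
    exact Submodule.add_mem _ (Submodule.mem_iSup_of_mem n hps) (ih hs)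

lemma jacobiForm_eq_zero_of_ne (hκ : ∀ i, -1 < κ i) {m n : ℕ} (hmn : m ≠ n)
    {p q : MvPolynomial (Fin d) ℝ} (hp : p ∈ orthSubmodule hκ m) (hq : q ∈ orthSubmodule hκ n) :
    jacobiForm hκ p q = 0 := by
  rcases hmn.lt_or_gt with h | h
  · exact hq.2 p (polyLT_mono h hp.1)
  · rw [jacobiForm_comm]
    exact hp.2 q (polyLT_mono h hq.1)

/-- `L²(T^d, W_κ)` is the Hilbert sum of the spaces `V_n^d(W_κ)`. -/
theorem isHilbertSum_orthSubmodule (hκ : ∀ i, -1 < κ i) :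
    IsHilbertSum ℝ (fun n => (orthSubmodule hκ n).map (polyToLp hκ))
      fun n => ((orthSubmodule hκ n).map (polyToLp hκ)).subtypeₗᵢ := by
  refine IsHilbertSum.mkInternal (F := fun n => (orthSubmodule hκ n).map (polyToLp hκ)) ?_ ?_
  · rintro m n hmn ⟨_, p, hp, rfl⟩ ⟨_, q, hq, rfl⟩
    have h := jacobiForm_eq_zero_of_ne hκ hmn hp hq
    rw [jacobiForm_apply] at h
    exact (mul_eq_zero.1 h).resolve_left (jacobiConst_pos hκ).ne'
  · rw [← topologicalClosure_range_polyToLp hκ, ← Submodule.map_iSup]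
    refine Submodule.topologicalClosure_mono ?_
    rintro _ ⟨p, rfl⟩
    exact ⟨p, polyLT_le_iSup_orthSubmodule hκ _ (mem_polyLT_succ.2 le_rfl), rfl⟩

/-- The orthogonal expansion of `f` in `L²(T^d, W_κ)`, with Parseval's identity; `r n` is the
component of `f` in `V_n^d(W_κ)`. -/
lemma exists_orthogonal_expansion (hκ : ∀ i, -1 < κ i) {f : (Fin d → ℝ) → ℝ}
    (hf : MemLp f 2 (jacobiMeasure κ)) :
    ∃ r : ℕ → MvPolynomial (Fin d) ℝ, (∀ n, r n ∈ orthSubmodule hκ n) ∧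
      (∀ n, ∀ q ∈ orthSubmodule hκ n, inner κ f (polyFun q) = jacobiForm hκ (r n) q) ∧
      HasSum (fun n => jacobiForm hκ (r n) (r n)) (inner κ f f) := by
  set Φ := (isHilbertSum_orthSubmodule hκ).linearIsometryEquiv with hΦ
  choose r hr hrw using fun n => (Φ hf.toLp n).2
  have hrw' : ∀ n, polyToLp hκ (r n) = (Φ hf.toLp n : Lp ℝ 2 (jacobiMeasure κ)) := hrw
  refine ⟨r, hr, fun n q hq => ?_, ?_⟩
  · have h1 : Φ.symm (lp.single 2 n ⟨polyToLp hκ q, q, hq, rfl⟩) = polyToLp hκ q := by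
      rw [hΦ, IsHilbertSum.linearIsometryEquiv_symm_apply_single]; rfl
    rw [inner_eq_inner_toLp hf (memLp_polyFun hκ q), jacobiForm_apply]
    congr 1
    change Inner.inner ℝ hf.toLp (polyToLp hκ q) = _
    rw [← h1, ← Φ.inner_map_map, LinearIsometryEquiv.apply_symm_apply, lp.inner_single_right, h1,
      hrw', Submodule.coe_inner]
  · have h := (lp.hasSum_inner (Φ hf.toLp) (Φ hf.toLp)).mul_left (jacobiConst κ)
    rw [Φ.inner_map_map, ← inner_eq_inner_toLp hf hf] at h
    convert! h using 2 with n
    rw [jacobiForm_apply, Submodule.coe_inner, hrw']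

/-! ### Tight frames and the reproducing kernel -/

/-- The polynomial whose function is `frameFun κ α n`. -/
noncomputable def framePoly (κ : Fin (d + 1) → ℝ) (α : Fin (d + 1) → ℕ) (n : ℕ) :
    MvPolynomial (Fin d) ℝ :=
  Real.sqrt (frameConst κ n (∑ i, α i) / frameWeight κ α) • orthProj κ n (monomialX α)

lemma frameFun_eq_polyFun (κ : Fin (d + 1) → ℝ) (α : Fin (d + 1) → ℕ) (n : ℕ) :
    frameFun κ α n = polyFun (framePoly κ α n) := by
  ext x
  simp [frameFun, framePoly, R, polyFun]

lemma framePoly_mem (hκ : ∀ i, -1 < κ i) (α : Fin (d + 1) → ℕ) (n : ℕ) :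
    framePoly κ α n ∈ orthSubmodule hκ n :=
  Submodule.smul_mem _ _ (orthProj_mem hκ n _)

/-- The tight frame property on `V_n^d(W_κ)`. -/
lemma hasSum_jacobiForm_framePoly_sq (hκ : ∀ i, -1 < κ i) {n N : ℕ} (hn : n ≤ N)
    {p : MvPolynomial (Fin d) ℝ} (hp : p ∈ orthSubmodule hκ n) :
    HasSum (fun α : MultiIndex d N => jacobiForm hκ p (framePoly κ α.1 n) ^ 2)
      (jacobiForm hκ p p) := by
  let e : MultiIndex d N ≃ (Finset.piAntidiag (Finset.univ : Finset (Fin (d + 1))) N) :=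
    Equiv.subtypeEquivRight fun α => by simp [Finset.mem_piAntidiag]
  have h := e.hasSum_iff.2 (Finset.hasSum (Finset.piAntidiag Finset.univ N)
    fun α => jacobiForm hκ p (framePoly κ α n) ^ 2)
  convert! h using 1
  rw [← sum_jacobiForm_mul_jacobiForm hκ hn hp hp, Finset.mul_sum]
  refine Finset.sum_congr rfl fun α hα => ?_
  have hα' : ∑ i, α i = N := (Finset.mem_piAntidiag.1 hα).1
  rw [framePoly, hα', map_smul, smul_eq_mul, mul_pow,
    Real.sq_sqrt (div_pos (frameConst_pos hκ hn) (frameWeight_pos hκ α)).le]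
  ring

lemma IsReproducingKernel.unique (hκ : ∀ i, -1 < κ i) {n : ℕ}
    {K K' : (Fin d → ℝ) → (Fin d → ℝ) → ℝ} (hK : IsReproducingKernel κ n K)
    (hK' : IsReproducingKernel κ n K') : K = K' := by
  ext x y
  obtain ⟨p, hp, hpK⟩ := hK.1 x
  obtain ⟨p', hp', hpK'⟩ := hK'.1 x
  have h : p = p' := by
    refine eq_of_forall_jacobiForm_eq hκ ((mem_orthPolys hκ).1 hp) ((mem_orthPolys hκ).1 hp')
      fun q hq => ?_
    have hq' : polyFun q ∈ orthPolyFuns κ n := ⟨q, (mem_orthPolys hκ).2 hq, rfl⟩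
    rw [← inner_polyFun, ← inner_polyFun, hpK, hpK', hK.2.2 _ hq', hK'.2.2 _ hq']
  exact (congr_fun hpK y).symm.trans ((congr_fun (h ▸ rfl) y).trans (congr_fun hpK' y))

lemma isReproducingKernel_sum (hκ : ∀ i, -1 < κ i) {n N : ℕ} (hn : n ≤ N) :
    IsReproducingKernel κ n fun x y => frameConst κ n N *
      ∑ α ∈ Finset.piAntidiag (Finset.univ : Finset (Fin (d + 1))) N,
        1 / frameWeight κ α * R κ α n x * R κ α n y := by
  let k : (Fin d → ℝ) → MvPolynomial (Fin d) ℝ := fun x => frameConst κ n N •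
    ∑ α ∈ Finset.piAntidiag (Finset.univ : Finset (Fin (d + 1))) N,
      ((frameWeight κ α)⁻¹ * R κ α n x) • orthProj κ n (monomialX α)
  have hk : ∀ x, k x ∈ orthSubmodule hκ n := fun x => Submodule.smul_mem _ _
    (Submodule.sum_mem _ fun α _ => Submodule.smul_mem _ _ (orthProj_mem hκ n _))
  have hkx : ∀ x y, polyFun (k x) y = frameConst κ n N *
      ∑ α ∈ Finset.piAntidiag (Finset.univ : Finset (Fin (d + 1))) N,
        1 / frameWeight κ α * R κ α n x * R κ α n y := fun x y => by
    simp [k, polyFun, R, map_sum]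
  refine ⟨fun x => ⟨k x, (mem_orthPolys hκ).2 (hk x), funext fun y => hkx x y⟩,
    fun y => ⟨k y, (mem_orthPolys hκ).2 (hk y), funext fun x => ?_⟩, ?_⟩
  · rw [hkx]
    congr 1
    exact Finset.sum_congr rfl fun α _ => by ring
  · rintro _ ⟨p, hp, rfl⟩ x
    rw [← funext fun y => hkx x y, inner_polyFun hκ]
    have h := congr_arg (fun q => polyFun q x)
      (sum_jacobiForm_smul_orthProj hκ hn ((mem_orthPolys hκ).1 hp))
    rw [← h]
    simp only [k, polyFun, R, map_sum, map_smul, MvPolynomial.smul_eval, LinearMap.smul_apply,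
      LinearMap.sum_apply, smul_eq_mul, jacobiForm_comm hκ p]
    congr 1
    exact Finset.sum_congr rfl fun α _ => by ring

end

end JacobiSimplex

theorem mainTheorem7 (d : ℕ) (κ : Fin (d + 1) → ℝ) (hκ : ∀ i, -1 < κ i) :
    -- the reproducing kernel and the orthogonal projections are well defined
    (∀ n : ℕ, ∃! K : (Fin d → ℝ) → (Fin d → ℝ) → ℝ,
      JacobiSimplex.IsReproducingKernel κ n K) ∧
    (∀ (n : ℕ) (α : Fin (d + 1) → ℕ), ∃! r : MvPolynomial (Fin d) ℝ,
      JacobiSimplex.IsOrthProj κ n (JacobiSimplex.monomialX α) r) ∧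
    -- the formula for the reproducing kernel
    (∀ n N : ℕ, n ≤ N → ∀ x y : Fin d → ℝ,
      JacobiSimplex.kernel κ n x y =
        JacobiSimplex.frameConst κ n N *
          ∑ α ∈ Finset.piAntidiag (Finset.univ : Finset (Fin (d + 1))) N,
            1 / JacobiSimplex.frameWeight κ α *
              JacobiSimplex.R κ α n x * JacobiSimplex.R κ α n y) ∧
    -- the normalized projections form a tight frame of the space of orthogonal polynomials
    (∀ n N : ℕ, n ≤ N →
      JacobiSimplex.IsTightFrame κ (JacobiSimplex.orthPolyFuns κ n)
        (fun α : JacobiSimplex.MultiIndex d N => JacobiSimplex.frameFun κ α.1 n) 1) ∧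
    -- and, for any choice of `N n ≥ n`, a tight frame of the weighted `L²` space
    (∀ N : ℕ → ℕ, (∀ n, n ≤ N n) →
      JacobiSimplex.IsTightFrame κ (JacobiSimplex.squareIntegrable κ)
        (fun i : (n : ℕ) × JacobiSimplex.MultiIndex d (N n) =>
          JacobiSimplex.frameFun κ i.2.1 i.1) 1) := by
  open JacobiSimplex in
  refine ⟨fun n => ⟨_, isReproducingKernel_sum hκ le_rfl,
      fun K hK => hK.unique hκ (isReproducingKernel_sum hκ le_rfl)⟩,
    fun n α => existsUnique_isOrthProj hκ n _, fun n N hn x y => ?_, fun n N hn => ?_,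
    fun N hN => ?_⟩
  · have h : IsReproducingKernel κ n (kernel κ n) :=
      Classical.epsilon_spec ⟨_, isReproducingKernel_sum hκ hn⟩
    exact congr_fun (congr_fun (h.unique hκ (isReproducingKernel_sum hκ hn)) x) y
  · refine ⟨one_pos, fun α => ?_, ?_⟩
    · exact ⟨_, (mem_orthPolys hκ).2 (framePoly_mem hκ α.1 n), (frameFun_eq_polyFun κ α.1 n).symm⟩
    · rintro _ ⟨p, hp, rfl⟩
      simp only [frameFun_eq_polyFun, inner_polyFun hκ, one_mul]
      exact hasSum_jacobiForm_framePoly_sq hκ hn ((mem_orthPolys hκ).1 hp)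
  · refine ⟨one_pos, fun i => ?_, fun f hf => ?_⟩
    · change frameFun κ i.2.1 i.1 ∈ _
      rw [frameFun_eq_polyFun]
      exact memLp_polyFun hκ _
    · obtain ⟨r, hr, hrf, hsum⟩ := exists_orthogonal_expansion hκ (f := f) hf
      have hterm : ∀ i : (n : ℕ) × MultiIndex d (N n), inner κ f (frameFun κ i.2.1 i.1) ^ 2 =
          jacobiForm hκ (r i.1) (framePoly κ i.2.1 i.1) ^ 2 := fun i => by
        rw [frameFun_eq_polyFun, hrf _ _ (framePoly_mem hκ _ _)]
      have hinner := fun n => hasSum_jacobiForm_framePoly_sq hκ (hN n) (hr n)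
      -- Summing the frame identity for each component `r n` over `n` gives Parseval's identity.
      simp only [hterm, one_mul]
      refine HasSum.sigma_of_hasSum hsum hinner
        ((summable_sigma_of_nonneg fun i => sq_nonneg _).2 ⟨fun n => (hinner n).summable, ?_⟩)
      simpa only [(hinner _).tsum_eq] using hsum.summable
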